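/- **Definitions.** Write $[A,B]=AB-BA$ and $\{A,B\}=AB+BA$. The rational degenerate Sklyanin algebra $\mathfrak{sK}_r$ is the unital associative $\mathbb{C}$-algebra with generators $S_0,S_3,S_+,S_-$ and relations $$[S_0,S_-]=-2\{S_-,S_-\},\qquad [S_0,S_+]=16\{S_3,S_-\}-16\{S_-,S_-\}+2\{S_+,S_-\}-4\{S_3,S_3\},$$ $$[S_+,S_-]=2\{S_0,S_3\},\qquad [S_0,S_3]=2\{S_3,S_-\}-8\{S_-,S_-\},\qquad [S_3,S_\pm]=\pm\{S_0,S_\pm\}.$$ With $(z)_k=z(z+1)\cdots(z+k-1)$, the Wilson polynomials are $$W_n(x^2|a,b,c,d)=(a+b)_n(a+c)_n(a+d)_n\;{}_4F_3\!\left({-n,\;n+a+b+c+d-1,\;a+ix,\;a-ix\atop a+b,\;a+c,\;a+d};1\right)$$ $$=\sum_{k=0}^n\frac{(-n)_k(n+a+b+c+d-1)_k}{k!}\,(a+b+k)_{n-k}(a+c+k)_{n-k}(a+d+k)_{n-k}\,\prod_{j=0}^{k-1}\big(x^2+(a+j)^2\big),$$ where the last expression, a polynomial in $x^2$, is used for all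 complex parameters. The rescaled Wilson polynomials are $\tilde W_n(x^2|a,b,c,d)=W_n(-x^2/4\,|\,a,b,c,d)$. **Proposition.** Let $a,b,c,d>0$ be real with $a+b\neq c+d$. Let $e_1,e_2,e_3,e_4$ be the elementary symmetric polynomials in $a,b,c,d$, and put $$\sigma=(a+b-c-d)^{-1},\quad \alpha=\tfrac12e_1^2-\tfrac43e_2,\quad \beta=-e_1^3+4e_1e_2-8e_3,\quad \xi=\tfrac1{16}\left(1-2e_1^2+e_1^4-256e_4\right).$$ Then the polynomials $\tilde W_n(x^2|a,b,c,d)$, $n\ge0$, form a basis of the space $\mathcal P$ of complex polynomials in $x^2$. Abbreviate $$\tilde W_n=\tilde W_n(x^2|a,b,c,d),\qquad A_n=\tilde W_n(x^2|a-\tfrac12,b-\tfrac12,c+\tfrac12,d+\tfrac12),\qquad B_n=\tilde W_n(x^2|a+\tfrac12,b+\tfrac12,c-\tfrac12,d-\tfrac12),$$ $$D_{n-1}=\tilde W_{n-1}(x^2|a+\tfrac12,b+\tfrac12,c+\tfrac12,d+\tfrac12),\qquad E_{n+1}=\tilde W_{n+1}(x^2|a-\tfrac12,b-\tfrac12,c-\tfrac12,d-\tfrac12)$$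 (for $n=0$ the terms with $D_{n-1}$ below have coefficient $0$ and are omitted). There is exactly one representation (unital algebra homomorphism) $\mathfrak{sK}_r\to\mathrm{End}_{\mathbb C}(\mathcal P)$ such that for all $n\ge0$ $$S_0\cdot\tilde W_n=4\sigma(n+c+d-1)B_n+\big(4\sigma(ab-cd)-e_1\big)n(n+e_1-1)D_{n-1}-4\sigma(n+a+b-1)A_n,$$ $$S_3\cdot\tilde W_n=-4(n+a+b-1)A_n+\tfrac12\big(8(ab+cd)-e_1^2-1\big)n(n+e_1-1)D_{n-1}-4(n+c+d-1)B_n,$$ $$S_-\cdot\tilde W_n=-\tfrac12n(n+e_1-1)D_{n-1},$$ $$S_+\cdot\tilde W_n=128\,E_{n+1}+8(6\alpha-1+2\beta\sigma)(n+a+b-1)A_n+8(6\alpha-1-2\beta\sigma)(n+c+d-1)B_n$$ $$\qquad\qquad+8\big[(1-6\alpha)(ab+cd)-2\beta\sigma(ab-cd)+\xi\big]n(n+e_1-1)D_{n-1}.$$ -/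

import Mathlib

namespace RationalSklyanin

open Polynomial

/-- The Pochhammer symbol `(z)_k = z (z + 1) ⋯ (z + k - 1)`. -/
noncomputable def poch (z : ℂ) (k : ℕ) : ℂ := (ascPochhammer ℂ k).eval z

/-- The Wilson polynomial `W_n(y | a, b, c, d)`, as a polynomial in `y = x²`.  The prefactor
`(a+b)_n (a+c)_n (a+d)_n` is absorbed in the terms of the hypergeometric sum, by
`(u)_n / (u)_k = (u + k)_{n-k}`, so that the definition makes sense for all parameters, and
`(a + i x)_k (a - i x)_k` is written as `∏_{j < k} (x² + (a + j)²)`;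
see `wilson_eval_sq` for the usual form. -/
noncomputable def wilson (n : ℕ) (a b c d : ℂ) : ℂ[X] :=
  ∑ k ∈ Finset.range (n + 1),
    C (poch (-n) k * poch (n + a + b + c + d - 1) k / (k.factorial : ℂ)
        * (poch (a + b + k) (n - k) * poch (a + c + k) (n - k) * poch (a + d + k) (n - k)))
      * ∏ j ∈ Finset.range k, (X + C ((a + j) ^ 2))

/-- The rescaled Wilson polynomial `W̃_n(y | a, b, c, d) = W_n(-y / 4 | a, b, c, d)`. -/
noncomputable def wilsonTilde (n : ℕ) (a b c d : ℂ) : ℂ[X] :=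
  (wilson n a b c d).comp (C (-1 / 4) * X)

/-- The generalized hypergeometric series `₄F₃(a₁, a₂, a₃, a₄; b₁, b₂, b₃; z)`. -/
noncomputable def hyp4F3 (a₁ a₂ a₃ a₄ b₁ b₂ b₃ z : ℂ) : ℂ :=
  ∑' k : ℕ, poch a₁ k * poch a₂ k * poch a₃ k * poch a₄ k
    / (poch b₁ k * poch b₂ k * poch b₃ k * (k.factorial : ℂ)) * z ^ k

theorem poch_split (z : ℂ) {k n : ℕ} (h : k ≤ n) : poch z n = poch z k * poch (z + k) (n - k) := by
  obtain ⟨m, rfl⟩ := Nat.exists_eq_add_of_le h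
  have := congrArg (Polynomial.eval z) (ascPochhammer_mul ℂ k m)
  simp only [poch, Nat.add_sub_cancel_left, ← this]
  simp

theorem poch_mul_conj (a x : ℂ) (k : ℕ) :
    poch (a + Complex.I * x) k * poch (a - Complex.I * x) k
      = ∏ j ∈ Finset.range k, (x ^ 2 + (a + j) ^ 2) := by
  induction k with
  | zero => simp [poch]
  | succ k ih =>
    rw [Finset.prod_range_succ, ← ih]
    simp only [poch, ascPochhammer_succ_eval]
    linear_combination (-((ascPochhammer ℂ k).eval (a + Complex.I * x)
      * (ascPochhammer ℂ k).eval (a - Complex.I * x)) * x ^ 2) * Complex.I_sq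

/-- The usual hypergeometric form of the Wilson polynomials. -/
theorem wilson_eval_sq (n : ℕ) (a b c d x : ℂ)
    (hb : poch (a + b) n ≠ 0) (hc : poch (a + c) n ≠ 0) (hd : poch (a + d) n ≠ 0) :
    (wilson n a b c d).eval (x ^ 2) = poch (a + b) n * poch (a + c) n * poch (a + d) n
      * hyp4F3 (-n) (n + a + b + c + d - 1) (a + Complex.I * x) (a - Complex.I * x)
          (a + b) (a + c) (a + d) 1 := by
  have hz : ∀ k ∉ Finset.range (n + 1), poch (-n) k = 0 := by
    intro k hk
    exact ascPochhammer_eval_neg_coe_nat_of_lt (by simpa using hk)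
  rw [hyp4F3, tsum_eq_sum (s := Finset.range (n + 1)) (fun k hk => by simp [hz k hk]),
    Finset.mul_sum, wilson, eval_finsetSum]
  refine Finset.sum_congr rfl fun k hk => ?_
  have hk' : k ≤ n := by simpa [Nat.lt_succ_iff] using hk
  rw [poch_split _ hk'] at hb hc hd
  rw [poch_split (a + b) hk', poch_split (a + c) hk', poch_split (a + d) hk']
  have h1 := left_ne_zero_of_mul hb
  have h2 := left_ne_zero_of_mul hc
  have h3 := left_ne_zero_of_mul hd
  have h4 : (k.factorial : ℂ) ≠ 0 := by exact_mod_cast k.factorial_ne_zero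
  simp only [eval_mul, eval_C, eval_prod, eval_add, eval_X]
  rw [← poch_mul_conj]
  field_simp
  simp

/-- The names of the four generators `S₀`, `S₃`, `S₊`, `S₋`. -/
inductive Gen
  | zero
  | three
  | plus
  | minus

/-- The anticommutator `{x, y} = x y + y x`. -/
def acomm {A : Type*} [Ring A] (x y : A) : A := x * y + y * x

/-- A generator, in the free unital associative algebra. -/
def gen (g : Gen) : FreeAlgebra ℂ Gen := FreeAlgebra.ι ℂ g

/-- The defining relations; `⁅x, y⁆ = x y - y x`. -/
inductive Rel : FreeAlgebra ℂ Gen → FreeAlgebra ℂ Gen → Prop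
  | zero_minus : Rel ⁅gen .zero, gen .minus⁆ (-(2 : ℂ) • acomm (gen .minus) (gen .minus))
  | zero_plus : Rel ⁅gen .zero, gen .plus⁆
      ((16 : ℂ) • acomm (gen .three) (gen .minus) - (16 : ℂ) • acomm (gen .minus) (gen .minus)
        + (2 : ℂ) • acomm (gen .plus) (gen .minus) - (4 : ℂ) • acomm (gen .three) (gen .three))
  | plus_minus : Rel ⁅gen .plus, gen .minus⁆ ((2 : ℂ) • acomm (gen .zero) (gen .three))
  | zero_three : Rel ⁅gen .zero, gen .three⁆
      ((2 : ℂ) • acomm (gen .three) (gen .minus) - (8 : ℂ) • acomm (gen .minus) (gen .minus))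
  | three_plus : Rel ⁅gen .three, gen .plus⁆ (acomm (gen .zero) (gen .plus))
  | three_minus : Rel ⁅gen .three, gen .minus⁆ (-acomm (gen .zero) (gen .minus))

/-- The rational degenerate Sklyanin algebra, as a unital associative algebra over `ℂ`. -/
abbrev SkAlg : Type := RingQuot Rel

/-- The generators `S₀`, `S₃`, `S₊`, `S₋` of the rational degenerate Sklyanin algebra. -/
noncomputable def S (g : Gen) : SkAlg := RingQuot.mkAlgHom ℂ Rel (gen g)

section Coefficients

variable (a b c d : ℂ)

/-- The elementary symmetric polynomials `e₁, …, e₄` in the four parameters. -/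
def e1 : ℂ := a + b + c + d
def e2 : ℂ := a * b + a * c + a * d + b * c + b * d + c * d
def e3 : ℂ := a * b * c + a * b * d + a * c * d + b * c * d
def e4 : ℂ := a * b * c * d

noncomputable def sigma : ℂ := (a + b - c - d)⁻¹

noncomputable def alpha : ℂ := e1 a b c d ^ 2 / 2 - 4 / 3 * e2 a b c d

def beta : ℂ := -e1 a b c d ^ 3 + 4 * e2 a b c d * e1 a b c d - 8 * e3 a b c d

noncomputable def xi : ℂ := 1 / 16 * (1 - 2 * e1 a b c d ^ 2 + e1 a b c d ^ 4 - 256 * e4 a b c d)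

end Coefficients

end RationalSklyanin

open RationalSklyanin

namespace RationalSklyanin

open Polynomial

/-! Up to scalar factors, each parameter shift in the formulas is the action on polynomials in x² of
a difference operator f ↦ (φ(x) f(x+1) - φ(-x) f(x-1)) / x. The symbol φ is 1 for D,
(a-1/2+x/2)(b-1/2+x/2) for A, the same product in c, d for B, and the product of all four factors
for E. These are the `diffNum_…_wilsonTilde` lemmas, proved by comparing coefficients in the
products `pochPair`.

Hence the prescribed images of the basis elements come from four difference operators. The factor σ
cancels in their symbols (`sigma_mul_sub`), leaving polynomials in x and the elementary symmetric
functions. The product of two such operators involves only the values of f at (x+2)², x² and (x-2)²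
(`IsDiffOp.comp_eval`), so each defining relation reduces to an identity of rational functions in x,
valid for arbitrary s₁, …, s₄.

A degree count gives the basis (`degree_wilsonTilde`). Uniqueness holds because the generators
generate the algebra and their action is fixed on a basis. -/

/-! ### Pochhammer symbols and the expansion of Wilson polynomials -/

theorem poch_zero (z : ℂ) : poch z 0 = 1 := by simp [poch]

theorem poch_succ_right (z : ℂ) (k : ℕ) : poch z (k + 1) = poch z k * (z + k) := by
  simp [poch, ascPochhammer_succ_eval]

theorem poch_succ_left (z : ℂ) (k : ℕ) : poch z (k + 1) = z * poch (z + 1) k := by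
  simp [poch, ascPochhammer_succ_left]

theorem mul_poch_add_one (z : ℂ) (k : ℕ) : z * poch (z + 1) k = poch z k * (z + k) := by
  rw [← poch_succ_left, poch_succ_right]

theorem poch_neg_natCast_of_lt {n k : ℕ} (h : n < k) : poch (-n) k = 0 :=
  ascPochhammer_eval_neg_coe_nat_of_lt h

/-- The coefficient of `∏_{j < k} (y + (a + j)²)` in `W_n(y | a, b, c, d)`. -/
noncomputable def wilsonCoeff (n : ℕ) (a b c d : ℂ) (k : ℕ) : ℂ :=
  poch (-n) k * poch (n + a + b + c + d - 1) k / (k.factorial : ℂ)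
    * (poch (a + b + k) (n - k) * poch (a + c + k) (n - k) * poch (a + d + k) (n - k))

theorem wilsonCoeff_of_lt {n k : ℕ} (h : n < k) (a b c d : ℂ) : wilsonCoeff n a b c d k = 0 := by
  simp [wilsonCoeff, poch_neg_natCast_of_lt h]

/-- The even function `(a - x/2)_k (a + x/2)_k = ∏_{j < k} ((a + j)² - x²/4)`. -/
noncomputable def pochPair (a : ℂ) (k : ℕ) (x : ℂ) : ℂ := poch (a - x / 2) k * poch (a + x / 2) k

theorem pochPair_eq_prod (a : ℂ) (k : ℕ) (x : ℂ) :
    pochPair a k x = ∏ j ∈ Finset.range k, (-1 / 4 * x ^ 2 + (a + j) ^ 2) := by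
  induction k with
  | zero => simp [pochPair, poch_zero]
  | succ k ih =>
    rw [Finset.prod_range_succ, ← ih]
    simp only [pochPair, poch_succ_right]
    ring

theorem pochPair_succ (a : ℂ) (k : ℕ) (x : ℂ) :
    pochPair a (k + 1) x = pochPair a k x * ((a + k) ^ 2 - x ^ 2 / 4) := by
  simp only [pochPair, poch_succ_right]
  ring

theorem wilsonTilde_eval_sq (n : ℕ) (a b c d x : ℂ) :
    (wilsonTilde n a b c d).eval (x ^ 2)
      = ∑ k ∈ Finset.range (n + 1), wilsonCoeff n a b c d k * pochPair a k x := by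
  simp only [wilsonTilde, wilson, eval_comp, eval_finsetSum, eval_mul, eval_C, eval_prod, eval_add,
    eval_X, pochPair_eq_prod, wilsonCoeff]

/-! ### Difference operators -/

/-- `φ(x) f((x+1)²) - φ(-x) f((x-1)²)`. -/
noncomputable def diffNum (φ : ℂ → ℂ) (f : ℂ[X]) (x : ℂ) : ℂ :=
  φ x * f.eval ((x + 1) ^ 2) - φ (-x) * f.eval ((x - 1) ^ 2)

theorem diffNum_wilsonTilde (φ : ℂ → ℂ) (n : ℕ) (a b c d x : ℂ) :
    diffNum φ (wilsonTilde n a b c d) x = ∑ k ∈ Finset.range (n + 1), wilsonCoeff n a b c d k *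
      (φ x * pochPair a k (x + 1) - φ (-x) * pochPair a k (x - 1)) := by
  rw [diffNum, wilsonTilde_eval_sq, wilsonTilde_eval_sq, Finset.mul_sum, Finset.mul_sum,
    ← Finset.sum_sub_distrib]
  exact Finset.sum_congr rfl fun k _ => by ring

theorem pochPair_add_one (a : ℂ) (k : ℕ) (x : ℂ) :
    pochPair a k (x + 1) = poch (a - 1/2 - x/2) k * poch (a + 1/2 + x/2) k := by
  rw [pochPair]; congr 2 <;> ring

theorem pochPair_sub_one (a : ℂ) (k : ℕ) (x : ℂ) :
    pochPair a k (x - 1) = poch (a + 1/2 - x/2) k * poch (a - 1/2 + x/2) k := by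
  rw [pochPair]; congr 2 <;> ring

/-- By z (z+1)_k = (z)_k (z+k), the extra linear factor turns the shifted product into one with a
lowered by 1/2. This serves the operators whose symbol contains a-1/2+x/2. -/
theorem mul_pochPair_add_one (a : ℂ) (k : ℕ) (x : ℂ) :
    (a - 1/2 + x/2) * pochPair a k (x + 1) = pochPair (a - 1/2) k x * (a - 1/2 + x/2 + k) := by
  have h := mul_poch_add_one (a - 1/2 + x/2) k
  rw [show a - 1/2 + x/2 + 1 = a + 1/2 + x/2 by ring] at h
  rw [pochPair_add_one, pochPair]
  linear_combination poch (a - 1/2 - x/2) k * h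

theorem mul_pochPair_sub_one (a : ℂ) (k : ℕ) (x : ℂ) :
    (a - 1/2 - x/2) * pochPair a k (x - 1) = pochPair (a - 1/2) k x * (a - 1/2 - x/2 + k) := by
  have h := mul_poch_add_one (a - 1/2 - x/2) k
  rw [show a - 1/2 - x/2 + 1 = a + 1/2 - x/2 by ring] at h
  rw [pochPair_sub_one, pochPair]
  linear_combination poch (a - 1/2 + x/2) k * h

/-- When the symbol lacks the factor in a, the shift is absorbed by raising a by 1/2, at the cost of
one degree. The shift x-1 has the same common factor. -/
theorem pochPair_succ_add_one (a : ℂ) (k : ℕ) (x : ℂ) :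
    pochPair a (k + 1) (x + 1)
      = pochPair (a + 1/2) k x * ((a - 1/2 - x/2) * (a + 1/2 + x/2 + k)) := by
  rw [pochPair_add_one, pochPair, poch_succ_left, poch_succ_right,
    show a - 1/2 - x/2 + 1 = a + 1/2 - x/2 by ring]
  ring

theorem pochPair_succ_sub_one (a : ℂ) (k : ℕ) (x : ℂ) :
    pochPair a (k + 1) (x - 1)
      = pochPair (a + 1/2) k x * ((a - 1/2 + x/2) * (a + 1/2 - x/2 + k)) := by
  rw [pochPair_sub_one, pochPair, poch_succ_right, poch_succ_left,
    show a - 1/2 + x/2 + 1 = a + 1/2 + x/2 by ring]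
  ring

/-- The operator lowering the degree and raising all four parameters. -/
theorem diffNum_one_wilsonTilde (n : ℕ) (a b c d x : ℂ) :
    diffNum (fun _ => 1) (wilsonTilde n a b c d) x
      = x * (n * (n + e1 a b c d - 1) *
        (wilsonTilde (n - 1) (a + 1/2) (b + 1/2) (c + 1/2) (d + 1/2)).eval (x ^ 2)) := by
  rw [diffNum_wilsonTilde, wilsonTilde_eval_sq]
  cases n with
  -- Here `n - 1` is truncated to 0, harmlessly, since the coefficient contains n.
  | zero => simp [pochPair, poch_zero]
  | succ n =>
    rw [Finset.sum_range_succ', Nat.add_sub_cancel, Finset.mul_sum, Finset.mul_sum]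
    simp only [pochPair, poch_zero, mul_one, sub_self, mul_zero, add_zero]
    refine Finset.sum_congr rfl fun k _ => ?_
    have hf : ((k.factorial : ℕ) : ℂ) ≠ 0 := by exact_mod_cast k.factorial_ne_zero
    have hk : (k + 1 : ℂ) ≠ 0 := by exact_mod_cast k.succ_ne_zero
    -- The factor -(k+1) comes from the difference of the two shifts of `pochPair a (k + 1)`, which
    -- is -(k+1) x `pochPair (a + 1/2) k x`.
    have h : wilsonCoeff (n + 1) a b c d (k + 1) * -(k + 1 : ℂ) = (n + 1) * (n + e1 a b c d)
        * wilsonCoeff n (a + 1/2) (b + 1/2) (c + 1/2) (d + 1/2) k := by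
      simp only [wilsonCoeff, e1, poch_succ_left _ k, Nat.factorial_succ]
      push_cast
      rw [show -((n : ℂ) + 1) + 1 = -n by ring,
        show (n : ℂ) + 1 + a + b + c + d - 1 + 1
          = n + (a + 1/2) + (b + 1/2) + (c + 1/2) + (d + 1/2) - 1 by ring,
        show a + b + ((k : ℂ) + 1) = a + 1/2 + (b + 1/2) + k by ring,
        show a + c + ((k : ℂ) + 1) = a + 1/2 + (c + 1/2) + k by ring,
        show a + d + ((k : ℂ) + 1) = a + 1/2 + (d + 1/2) + k by ring]
      field_simp
      ring
    have h2 := pochPair_succ_add_one a k x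
    have h3 := pochPair_succ_sub_one a k x
    simp only [pochPair] at h2 h3
    rw [h2, h3]
    push_cast
    linear_combination x * poch (a + 1/2 - x/2) k * poch (a + 1/2 + x/2) k * h

/-- The operator lowering `a, b` and raising `c, d`. -/
theorem diffNum_ab_wilsonTilde (n : ℕ) (a b c d x : ℂ) :
    diffNum (fun x => (a - 1/2 + x/2) * (b - 1/2 + x/2)) (wilsonTilde n a b c d) x
      = x * ((n + a + b - 1) *
        (wilsonTilde n (a - 1/2) (b - 1/2) (c + 1/2) (d + 1/2)).eval (x ^ 2)) := by
  rw [diffNum_wilsonTilde, wilsonTilde_eval_sq, Finset.mul_sum, Finset.mul_sum]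
  refine Finset.sum_congr rfl fun k hk => ?_
  have hk' : k ≤ n := by simpa [Nat.lt_succ_iff] using hk
  -- The k-th bracket collapses to x (a+b-1+k) `pochPair (a - 1/2) k x`, so both sides can be
  -- compared term by term.
  have h : wilsonCoeff n a b c d k * (a + b - 1 + k) = (n + a + b - 1)
      * wilsonCoeff n (a - 1/2) (b - 1/2) (c + 1/2) (d + 1/2) k := by
    have h := mul_poch_add_one (a + b - 1 + k) (n - k)
    rw [Nat.cast_sub hk', show a + b - 1 + (k : ℂ) + 1 = a + b + k by ring] at h
    simp only [wilsonCoeff]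
    rw [show (n : ℂ) + (a - 1/2) + (b - 1/2) + (c + 1/2) + (d + 1/2) - 1
          = n + a + b + c + d - 1 by ring,
        show a - 1/2 + (b - 1/2) + (k : ℂ) = a + b - 1 + k by ring,
        show a - 1/2 + (c + 1/2) + (k : ℂ) = a + c + k by ring,
        show a - 1/2 + (d + 1/2) + (k : ℂ) = a + d + k by ring]
    linear_combination poch (-n) k * poch (n + a + b + c + d - 1) k / (k.factorial : ℂ)
      * (poch (a + c + k) (n - k) * poch (a + d + k) (n - k)) * h
  have h1 := mul_pochPair_add_one a k x
  have h2 := mul_pochPair_sub_one a k x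
  linear_combination wilsonCoeff n a b c d k * ((b - 1/2 + x/2) * h1 - (b - 1/2 - x/2) * h2)
    + x * pochPair (a - 1/2) k x * h

/-- The operator raising `a, b` and lowering `c, d`. -/
theorem diffNum_cd_wilsonTilde (n : ℕ) (a b c d x : ℂ) :
    diffNum (fun x => (c - 1/2 + x/2) * (d - 1/2 + x/2)) (wilsonTilde n a b c d) x
      = x * ((n + c + d - 1) *
        (wilsonTilde n (a + 1/2) (b + 1/2) (c - 1/2) (d - 1/2)).eval (x ^ 2)) := by
  -- Without the factor in a, two neighbouring basis products appear. At k = 0 the truncated index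
  -- `k - 1` is multiplied by 0.
  have key : ∀ k : ℕ, (c - 1/2 + x/2) * (d - 1/2 + x/2) * pochPair a k (x + 1)
      - (c - 1/2 + -x/2) * (d - 1/2 + -x/2) * pochPair a k (x - 1)
      = x * ((k + c + d - 1) * pochPair (a + 1/2) k x
        - k * (a + c + k - 1) * (a + d + k - 1) * pochPair (a + 1/2) (k - 1) x) := by
    rintro (_ | k)
    · simp only [pochPair, poch_zero]; push_cast; ring
    · rw [pochPair_succ_add_one, pochPair_succ_sub_one, Nat.add_sub_cancel, pochPair_succ]
      push_cast; ring
  have hcoeff : ∀ k ∈ Finset.range (n + 1), wilsonCoeff n a b c d k * (k + c + d - 1)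
      - wilsonCoeff n a b c d (k + 1) * ((k + 1) * (a + c + k) * (a + d + k))
      = (n + c + d - 1) * wilsonCoeff n (a + 1/2) (b + 1/2) (c - 1/2) (d - 1/2) k := by
    intro k hk
    have hk' : k ≤ n := by simpa [Nat.lt_succ_iff] using hk
    have e1' : (n : ℂ) + (a + 1/2) + (b + 1/2) + (c - 1/2) + (d - 1/2) - 1
          = n + a + b + c + d - 1 := by ring
    have e2' : a + 1/2 + (b + 1/2) + (k : ℂ) = a + b + k + 1 := by ring
    have e3' : a + 1/2 + (c - 1/2) + (k : ℂ) = a + c + k := by ring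
    have e4' : a + 1/2 + (d - 1/2) + (k : ℂ) = a + d + k := by ring
    rcases hk'.eq_or_lt with rfl | hlt
    · rw [wilsonCoeff_of_lt (Nat.lt_succ_self k)]
      simp only [wilsonCoeff, Nat.sub_self, poch_zero, e1']
      ring
    · obtain ⟨m, rfl⟩ : ∃ m, n = k + m + 1 := ⟨n - k - 1, by omega⟩
      have hf : ((k.factorial : ℕ) : ℂ) ≠ 0 := by exact_mod_cast k.factorial_ne_zero
      have hk1 : (k + 1 : ℂ) ≠ 0 := by exact_mod_cast k.succ_ne_zero
      simp only [wilsonCoeff, e1', e2', e3', e4']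
      rw [show k + m + 1 - k = m + 1 by omega, show k + m + 1 - (k + 1) = m by omega,
        poch_succ_right (a + b + k + 1) m, poch_succ_left (a + b + k) m,
        poch_succ_left (a + c + k) m, poch_succ_left (a + d + k) m,
        poch_succ_right _ k, poch_succ_right _ k, Nat.factorial_succ]
      push_cast
      rw [show a + b + ((k : ℂ) + 1) = a + b + k + 1 by ring,
        show a + c + ((k : ℂ) + 1) = a + c + k + 1 by ring,
        show a + d + ((k : ℂ) + 1) = a + d + k + 1 by ring]
      field_simp
      ring
  rw [diffNum_wilsonTilde, wilsonTilde_eval_sq, Finset.mul_sum, Finset.mul_sum]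
  simp only [key]
  calc _ = x * (∑ k ∈ Finset.range (n + 1),
          wilsonCoeff n a b c d k * (k + c + d - 1) * pochPair (a + 1/2) k x
        - ∑ k ∈ Finset.range (n + 1), wilsonCoeff n a b c d k
          * (k * (a + c + k - 1) * (a + d + k - 1)) * pochPair (a + 1/2) (k - 1) x) := by
        rw [← Finset.sum_sub_distrib, Finset.mul_sum]
        exact Finset.sum_congr rfl fun k _ => by ring
    _ = x * (∑ k ∈ Finset.range (n + 1),
          wilsonCoeff n a b c d k * (k + c + d - 1) * pochPair (a + 1/2) k x
        - ∑ k ∈ Finset.range (n + 1), wilsonCoeff n a b c d (k + 1)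
          * ((k + 1) * (a + c + k) * (a + d + k)) * pochPair (a + 1/2) k x) := by
        -- Reindexing k ↦ k+1 has no boundary terms: the k = 0 term has a factor k, and the
        -- coefficient of index n+1 vanishes.
        rw [Finset.sum_range_succ' (fun k : ℕ => wilsonCoeff n a b c d k
          * (k * (a + c + k - 1) * (a + d + k - 1)) * pochPair (a + 1/2) (k - 1) x),
          Finset.sum_range_succ (fun k : ℕ => wilsonCoeff n a b c d (k + 1)
          * ((k + 1) * (a + c + k) * (a + d + k)) * pochPair (a + 1/2) k x),
          wilsonCoeff_of_lt (Nat.lt_succ_self n)]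
        push_cast
        simp only [zero_mul, mul_zero, add_zero]
        congr 2
        exact Finset.sum_congr rfl fun k _ => by ring
    _ = _ := by
        rw [← Finset.sum_sub_distrib, Finset.mul_sum]
        refine Finset.sum_congr rfl fun k hk => ?_
        linear_combination x * pochPair (a + 1/2) k x * hcoeff k hk

/-- The operator raising the degree and lowering all four parameters. -/
theorem diffNum_abcd_wilsonTilde (n : ℕ) (a b c d x : ℂ) :
    diffNum (fun x => (a - 1/2 + x/2) * (b - 1/2 + x/2) * (c - 1/2 + x/2) * (d - 1/2 + x/2))
        (wilsonTilde n a b c d) x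
      = x * (wilsonTilde (n + 1) (a - 1/2) (b - 1/2) (c - 1/2) (d - 1/2)).eval (x ^ 2) := by
  -- After extracting `pochPair (a - 1/2) k x`, an odd polynomial of degree at most 3 remains.
  -- Divided by x it is linear in x². Its value at x/2 = a-1/2+k gives the triple product, and the
  -- remainder is a multiple of (a-1/2+k)² - x²/4, the next factor of `pochPair`.
  have key : ∀ k : ℕ, (a - 1/2 + x/2) * (b - 1/2 + x/2) * (c - 1/2 + x/2) * (d - 1/2 + x/2)
        * pochPair a k (x + 1)
      - (a - 1/2 + -x/2) * (b - 1/2 + -x/2) * (c - 1/2 + -x/2) * (d - 1/2 + -x/2)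
        * pochPair a k (x - 1)
      = x * ((a + b - 1 + k) * (a + c - 1 + k) * (a + d - 1 + k) * pochPair (a - 1/2) k x
        - (k + e1 a b c d - 2) * pochPair (a - 1/2) (k + 1) x) := by
    intro k
    have h1 := mul_pochPair_add_one a k x
    have h2 := mul_pochPair_sub_one a k x
    rw [pochPair_succ, e1]
    linear_combination (b - 1/2 + x/2) * (c - 1/2 + x/2) * (d - 1/2 + x/2) * h1
      - (b - 1/2 - x/2) * (c - 1/2 - x/2) * (d - 1/2 - x/2) * h2
  have e1' : ((n + 1 : ℕ) : ℂ) + (a - 1/2) + (b - 1/2) + (c - 1/2) + (d - 1/2) - 1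
      = n + a + b + c + d - 2 := by push_cast; ring
  have hprod : ∀ (z : ℂ) (k : ℕ), k ≤ n →
      poch (z - 1/2 - 1/2 + k) (n + 1 - k) = (z - 1 + k) * poch (z + k) (n - k) := by
    intro z k hk
    rw [Nat.succ_sub hk, poch_succ_left]
    congr 1
    · ring
    · congr 1; ring
  have hcoeff0 : wilsonCoeff n a b c d 0 * ((a + b - 1) * (a + c - 1) * (a + d - 1))
      = wilsonCoeff (n + 1) (a - 1/2) (b - 1/2) (c - 1/2) (d - 1/2) 0 := by
    have hb := hprod (a + b) 0 n.zero_le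
    have hc := hprod (a + c) 0 n.zero_le
    have hd := hprod (a + d) 0 n.zero_le
    simp only [wilsonCoeff, poch_zero]
    rw [show a - 1/2 + (b - 1/2) = a + b - 1/2 - 1/2 by ring,
      show a - 1/2 + (c - 1/2) = a + c - 1/2 - 1/2 by ring,
      show a - 1/2 + (d - 1/2) = a + d - 1/2 - 1/2 by ring, hb, hc, hd]
    push_cast; ring
  have hcoeff : ∀ k ∈ Finset.range (n + 1), wilsonCoeff n a b c d (k + 1)
        * ((a + b + k) * (a + c + k) * (a + d + k))
      - wilsonCoeff n a b c d k * (k + e1 a b c d - 2)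
      = wilsonCoeff (n + 1) (a - 1/2) (b - 1/2) (c - 1/2) (d - 1/2) (k + 1) := by
    intro k hk
    have hk' : k ≤ n := by simpa [Nat.lt_succ_iff] using hk
    have hf : ((k.factorial : ℕ) : ℂ) ≠ 0 := by exact_mod_cast k.factorial_ne_zero
    have hk1 : (k + 1 : ℂ) ≠ 0 := by exact_mod_cast k.succ_ne_zero
    have hs : ∀ z w : ℂ, z - 1/2 + (w - 1/2) + ((k + 1 : ℕ) : ℂ) = z + w + k := by
      intro z w; push_cast; ring
    rcases hk'.eq_or_lt with rfl | hlt
    · rw [wilsonCoeff_of_lt (Nat.lt_succ_self k)]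
      simp only [wilsonCoeff, Nat.sub_self, poch_zero, e1', e1]
      rw [poch_succ_left _ k, poch_succ_left _ k, Nat.factorial_succ]
      push_cast
      rw [show -((k : ℂ) + 1) + 1 = -k by ring,
        show (k : ℂ) + a + b + c + d - 2 + 1 = k + a + b + c + d - 1 by ring]
      field_simp
      ring
    · obtain ⟨m, rfl⟩ : ∃ m, n = k + m + 1 := ⟨n - k - 1, by omega⟩
      simp only [wilsonCoeff, e1', hs]
      rw [show k + m + 1 - k = m + 1 by omega, show k + m + 1 - (k + 1) = m by omega,
        show k + m + 1 + 1 - (k + 1) = m + 1 by omega,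
        poch_succ_left (a + b + k) m,
        poch_succ_left (a + c + k) m, poch_succ_left (a + d + k) m,
        poch_succ_right (-((k + m + 1 : ℕ) : ℂ)) k,
        poch_succ_right (((k + m + 1 : ℕ) : ℂ) + a + b + c + d - 1) k,
        poch_succ_left _ k, poch_succ_left _ k, Nat.factorial_succ, e1]
      push_cast
      rw [show a + b + ((k : ℂ) + 1) = a + b + k + 1 by ring,
        show a + c + ((k : ℂ) + 1) = a + c + k + 1 by ring,
        show a + d + ((k : ℂ) + 1) = a + d + k + 1 by ring,
        show -((k : ℂ) + m + 1 + 1) + 1 = -(k + m + 1) by ring,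
        show (k : ℂ) + m + 1 + a + b + c + d - 2 + 1 = k + m + 1 + a + b + c + d - 1 by ring]
      field_simp
      ring
  rw [diffNum_wilsonTilde, wilsonTilde_eval_sq]
  simp only [key]
  calc _ = x * (∑ k ∈ Finset.range (n + 1 + 1), wilsonCoeff n a b c d k
          * ((a + b - 1 + k) * (a + c - 1 + k) * (a + d - 1 + k)) * pochPair (a - 1/2) k x
        - ∑ k ∈ Finset.range (n + 1), wilsonCoeff n a b c d k
          * (k + e1 a b c d - 2) * pochPair (a - 1/2) (k + 1) x) := by
        rw [Finset.sum_range_succ _ (n + 1), wilsonCoeff_of_lt (Nat.lt_succ_self n), zero_mul,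
          zero_mul, add_zero, ← Finset.sum_sub_distrib, Finset.mul_sum]
        exact Finset.sum_congr rfl fun k _ => by ring
    _ = _ := by
        rw [Finset.sum_range_succ', Finset.sum_range_succ' _ (n + 1), ← hcoeff0,
          add_sub_right_comm, ← Finset.sum_sub_distrib]
        congr 2
        · refine Finset.sum_congr rfl fun k hk => ?_
          rw [← hcoeff k hk]
          push_cast
          ring
        · push_cast; ring


/-! ### The basis of Wilson polynomials -/

theorem poch_ne_zero_of_re_pos {z : ℂ} (hz : 0 < z.re) (k : ℕ) : poch z k ≠ 0 := by
  induction k with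
  | zero => simp [poch_zero]
  | succ k ih =>
    rw [poch_succ_right]
    refine mul_ne_zero ih fun h => ?_
    have := congrArg Complex.re h
    simp only [Complex.add_re, Complex.natCast_re, Complex.zero_re] at this
    have : (0 : ℝ) ≤ k := k.cast_nonneg
    linarith

theorem poch_neg_natCast_self_ne_zero (n : ℕ) : poch (-n) n ≠ 0 := by
  induction n with
  | zero => simp [poch_zero]
  | succ n ih =>
    rw [poch_succ_left, show -((n + 1 : ℕ) : ℂ) + 1 = -n by push_cast; ring]
    exact mul_ne_zero (neg_ne_zero.mpr (by exact_mod_cast n.succ_ne_zero)) ih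

/-- Only the term k = n reaches degree n, and its coefficient is (-n)_n (n+a+b+c+d-1)_n / n!, where
(-n)_n never vanishes. -/
theorem degree_wilsonTilde {n : ℕ} {a b c d : ℂ} (h : poch (n + a + b + c + d - 1) n ≠ 0) :
    (wilsonTilde n a b c d).degree = n := by
  have hW : wilsonTilde n a b c d = ∑ k ∈ Finset.range (n + 1), C (wilsonCoeff n a b c d k)
      * ∏ j ∈ Finset.range k, (C (-1 / 4) * X + C ((a + j) ^ 2)) := by
    simp [wilsonTilde, wilson, wilsonCoeff, Polynomial.sum_comp, prod_comp]
  have hp : ∀ k : ℕ, (∏ j ∈ Finset.range k, (C (-1 / 4 : ℂ) * X + C ((a + j) ^ 2))).degree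
      = (k : WithBot ℕ) := by
    intro k
    rw [degree_prod, Finset.sum_congr rfl fun j _ => degree_linear (by norm_num)]
    simp
  have hc : wilsonCoeff n a b c d n ≠ 0 := by
    have hf : ((n.factorial : ℕ) : ℂ) ≠ 0 := by exact_mod_cast n.factorial_ne_zero
    simp only [wilsonCoeff, Nat.sub_self, poch_zero, mul_one]
    exact div_ne_zero (mul_ne_zero (poch_neg_natCast_self_ne_zero n) h) hf
  have hlead : (C (wilsonCoeff n a b c d n)
      * ∏ j ∈ Finset.range n, (C (-1 / 4) * X + C ((a + j) ^ 2))).degree = n := by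
    rw [degree_C_mul hc, hp]
  rw [hW, Finset.sum_range_succ, degree_add_eq_right_of_degree_lt, hlead]
  rw [hlead]
  refine (degree_sum_le _ _).trans_lt ((Finset.sup_lt_iff (WithBot.bot_lt_coe n)).mpr ?_)
  intro k hk
  refine (degree_mul_le _ _).trans_lt ?_
  rw [hp]
  calc _ ≤ (0 : WithBot ℕ) + k := by gcongr; exact degree_C_le
    _ < n := by rw [zero_add]; exact_mod_cast Finset.mem_range.mp hk

/-- The rescaled Wilson polynomials, as a sequence with one polynomial in each degree. -/
noncomputable def wilsonSequence {a b c d : ℂ}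
    (h : ∀ n : ℕ, poch (n + a + b + c + d - 1) n ≠ 0) : Polynomial.Sequence ℂ where
  elems' n := wilsonTilde n a b c d
  degree_eq' n := degree_wilsonTilde (h n)

/-- For n ≥ 1 the base n+a+b+c+d-1 is positive; for n = 0 the product is empty, whatever the sign of
the base. -/
theorem poch_wilson_ne_zero {a b c d : ℝ} (h : 0 < a + b + c + d) (n : ℕ) :
    poch (n + a + b + c + d - 1) n ≠ 0 := by
  cases n with
  | zero => simp [poch_zero]
  | succ n =>
    apply poch_ne_zero_of_re_pos
    have : (0 : ℝ) ≤ n := n.cast_nonneg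
    simp
    linarith

/-! ### Operators inducing difference operators, and their composition -/

/-- The endomorphism `L` acts on polynomials in `x²` by
`f ↦ (φ(x) f(x + 1) - φ(-x) f(x - 1)) / x`. -/
def IsDiffOp (φ : ℂ → ℂ) (L : Module.End ℂ ℂ[X]) : Prop :=
  ∀ f x, x * (L f).eval (x ^ 2) = diffNum φ f x

theorem isDiffOp_of_span {φ : ℂ → ℂ} {L : Module.End ℂ ℂ[X]} {w : ℕ → ℂ[X]}
    (hw : Submodule.span ℂ (Set.range w) = ⊤)
    (h : ∀ n x, x * (L (w n)).eval (x ^ 2) = diffNum φ (w n) x) : IsDiffOp φ L := by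
  intro f x
  have hf : f ∈ Submodule.span ℂ (Set.range w) := hw ▸ Submodule.mem_top
  induction hf using Submodule.span_induction with
  | mem f hf => obtain ⟨n, rfl⟩ := hf; exact h n x
  | zero => simp [diffNum]
  | add f g _ _ hf hg =>
    rw [map_add, eval_add, mul_add, hf, hg]
    simp only [diffNum, eval_add]; ring
  | smul r f _ hf =>
    rw [map_smul, eval_smul, smul_eq_mul, mul_left_comm, hf]
    simp only [diffNum, eval_smul, smul_eq_mul]; ring

/-- The outer operator divides by x and the inner one, evaluated at x ± 1, by x ± 1; hence the three
excluded points. -/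
theorem IsDiffOp.comp_eval {φ ψ : ℂ → ℂ} {L M : Module.End ℂ ℂ[X]} (hL : IsDiffOp φ L)
    (hM : IsDiffOp ψ M) (f : ℂ[X]) {x : ℂ} (h0 : x ≠ 0) (h1 : x + 1 ≠ 0) (h2 : x - 1 ≠ 0) :
    (L (M f)).eval (x ^ 2)
      = (φ x * (x - 1) * (ψ (x + 1) * f.eval ((x + 2) ^ 2) - ψ (-x - 1) * f.eval (x ^ 2))
        - φ (-x) * (x + 1) * (ψ (x - 1) * f.eval (x ^ 2) - ψ (1 - x) * f.eval ((x - 2) ^ 2)))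
        / (x * (x + 1) * (x - 1)) := by
  have e := hL (M f) x
  have ep := hM f (x + 1)
  have em := hM f (x - 1)
  simp only [diffNum] at e ep em
  rw [show x + 1 + 1 = x + 2 by ring, show x + 1 - 1 = x by ring,
    show -(x + 1) = -x - 1 by ring] at ep
  rw [show x - 1 + 1 = x by ring, show x - 1 - 1 = x - 2 by ring,
    show -(x - 1) = 1 - x by ring] at em
  rw [eq_div_iff (mul_ne_zero (mul_ne_zero h0 h1) h2)]
  linear_combination (x + 1) * (x - 1) * e + φ x * (x - 1) * ep - φ (-x) * (x + 1) * em

theorem polynomial_ext_of_eval_sq {p q : ℂ[X]}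
    (h : ∀ x : ℂ, x ≠ 0 → x + 1 ≠ 0 → x - 1 ≠ 0 → p.eval (x ^ 2) = q.eval (x ^ 2)) : p = q := by
  refine eq_of_infinite_eval_eq p q (((Set.finite_singleton (0 : ℂ)).union
    (Set.finite_singleton 1)).infinite_compl.mono fun y hy => ?_)
  obtain ⟨x, rfl⟩ := IsAlgClosed.exists_pow_nat_eq y two_pos
  simp only [Set.mem_compl_iff, Set.mem_union, Set.mem_singleton_iff, not_or] at hy
  refine h x (fun h => hy.1 (by rw [h]; norm_num)) (fun h => hy.2 ?_) (fun h => hy.2 ?_)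
  · linear_combination (x - 1) * h
  · linear_combination (x + 1) * h

/-! ### The representation -/

/-- The symbol of the operator `S₀`. -/
noncomputable def symbolZero (s₁ x : ℂ) : ℂ := 2 - 2 * x - s₁

/-- The symbol of the operator `S₃`. -/
noncomputable def symbolThree (s₁ x : ℂ) : ℂ :=
  2 * s₁ - 5/2 - 2 * x * (s₁ - 2) - 2 * x ^ 2 - s₁ ^ 2 / 2

/-- The symbol of the operator `S₊`; here `16 ∏ (t + aᵢ) = (2t)⁴ + ⋯` is taken at `t = (x-1)/2`. -/
noncomputable def symbolPlus (s₁ s₂ s₃ s₄ x : ℂ) : ℂ :=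
  8 * ((x - 1) ^ 4 + 2 * s₁ * (x - 1) ^ 3 + 4 * s₂ * (x - 1) ^ 2 + 8 * s₃ * (x - 1) + 16 * s₄)
    + 4 * (3 * s₁ ^ 2 - 8 * s₂ - 1) * (1 - s₁ + x * (s₁ - 2) + x ^ 2)
    + 8 * (-s₁ ^ 3 + 4 * s₂ * s₁ - 8 * s₃) * (x - 1)
    + 1/2 * (1 - 2 * s₁ ^ 2 + s₁ ^ 4 - 256 * s₄)

section Relations

variable {s₁ s₂ s₃ s₄ : ℂ} {L₀ L₃ Lp Lm : Module.End ℂ ℂ[X]}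

/-- As in the other five relations, the values of f at (x+2)², x² and (x-2)² are treated as
independent unknowns, and their coefficients on both sides agree as rational functions of x. -/
theorem lie_zero_minus (h₀ : IsDiffOp (symbolZero s₁) L₀) (hm : IsDiffOp (fun _ => -1/2) Lm) :
    ⁅L₀, Lm⁆ = -(2 : ℂ) • acomm Lm Lm := by
  refine LinearMap.ext fun f => polynomial_ext_of_eval_sq fun x x0 x1 x2 => ?_
  simp only [Ring.lie_def, acomm, LinearMap.sub_apply, LinearMap.add_apply, LinearMap.smul_apply,
    Module.End.mul_apply, eval_sub, eval_add, eval_smul, smul_eq_mul,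
    h₀.comp_eval hm f x0 x1 x2, hm.comp_eval h₀ f x0 x1 x2, hm.comp_eval hm f x0 x1 x2, symbolZero]
  field_simp
  ring

theorem lie_zero_three (h₀ : IsDiffOp (symbolZero s₁) L₀) (h₃ : IsDiffOp (symbolThree s₁) L₃)
    (hm : IsDiffOp (fun _ => -1/2) Lm) :
    ⁅L₀, L₃⁆ = (2 : ℂ) • acomm L₃ Lm - (8 : ℂ) • acomm Lm Lm := by
  refine LinearMap.ext fun f => polynomial_ext_of_eval_sq fun x x0 x1 x2 => ?_
  simp only [Ring.lie_def, acomm, LinearMap.sub_apply, LinearMap.add_apply, LinearMap.smul_apply,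
    Module.End.mul_apply, eval_sub, eval_add, eval_smul, smul_eq_mul,
    h₀.comp_eval h₃ f x0 x1 x2, h₃.comp_eval h₀ f x0 x1 x2, h₃.comp_eval hm f x0 x1 x2,
    hm.comp_eval h₃ f x0 x1 x2, hm.comp_eval hm f x0 x1 x2, symbolZero, symbolThree]
  field_simp
  ring

theorem lie_three_minus (h₀ : IsDiffOp (symbolZero s₁) L₀) (h₃ : IsDiffOp (symbolThree s₁) L₃)
    (hm : IsDiffOp (fun _ => -1/2) Lm) : ⁅L₃, Lm⁆ = -acomm L₀ Lm := by
  refine LinearMap.ext fun f => polynomial_ext_of_eval_sq fun x x0 x1 x2 => ?_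
  simp only [Ring.lie_def, acomm, LinearMap.sub_apply, LinearMap.add_apply, LinearMap.neg_apply,
    Module.End.mul_apply, eval_sub, eval_add, eval_neg,
    h₀.comp_eval hm f x0 x1 x2, hm.comp_eval h₀ f x0 x1 x2, h₃.comp_eval hm f x0 x1 x2,
    hm.comp_eval h₃ f x0 x1 x2, symbolZero, symbolThree]
  field_simp
  ring

theorem lie_plus_minus (h₀ : IsDiffOp (symbolZero s₁) L₀) (h₃ : IsDiffOp (symbolThree s₁) L₃)
    (hp : IsDiffOp (symbolPlus s₁ s₂ s₃ s₄) Lp) (hm : IsDiffOp (fun _ => -1/2) Lm) :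
    ⁅Lp, Lm⁆ = (2 : ℂ) • acomm L₀ L₃ := by
  refine LinearMap.ext fun f => polynomial_ext_of_eval_sq fun x x0 x1 x2 => ?_
  simp only [Ring.lie_def, acomm, LinearMap.sub_apply, LinearMap.add_apply, LinearMap.smul_apply,
    Module.End.mul_apply, eval_sub, eval_add, eval_smul, smul_eq_mul,
    h₀.comp_eval h₃ f x0 x1 x2, h₃.comp_eval h₀ f x0 x1 x2, hp.comp_eval hm f x0 x1 x2,
    hm.comp_eval hp f x0 x1 x2, symbolZero, symbolThree, symbolPlus]
  field_simp
  ring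

theorem lie_three_plus (h₀ : IsDiffOp (symbolZero s₁) L₀) (h₃ : IsDiffOp (symbolThree s₁) L₃)
    (hp : IsDiffOp (symbolPlus s₁ s₂ s₃ s₄) Lp) : ⁅L₃, Lp⁆ = acomm L₀ Lp := by
  refine LinearMap.ext fun f => polynomial_ext_of_eval_sq fun x x0 x1 x2 => ?_
  simp only [Ring.lie_def, acomm, LinearMap.sub_apply, LinearMap.add_apply,
    Module.End.mul_apply, eval_sub, eval_add,
    h₀.comp_eval hp f x0 x1 x2, hp.comp_eval h₀ f x0 x1 x2, h₃.comp_eval hp f x0 x1 x2,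
    hp.comp_eval h₃ f x0 x1 x2, symbolZero, symbolThree, symbolPlus]
  field_simp
  ring

theorem lie_zero_plus (h₀ : IsDiffOp (symbolZero s₁) L₀) (h₃ : IsDiffOp (symbolThree s₁) L₃)
    (hp : IsDiffOp (symbolPlus s₁ s₂ s₃ s₄) Lp) (hm : IsDiffOp (fun _ => -1/2) Lm) :
    ⁅L₀, Lp⁆ = (16 : ℂ) • acomm L₃ Lm - (16 : ℂ) • acomm Lm Lm + (2 : ℂ) • acomm Lp Lm
      - (4 : ℂ) • acomm L₃ L₃ := by
  refine LinearMap.ext fun f => polynomial_ext_of_eval_sq fun x x0 x1 x2 => ?_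
  simp only [Ring.lie_def, acomm, LinearMap.sub_apply, LinearMap.add_apply, LinearMap.smul_apply,
    Module.End.mul_apply, eval_sub, eval_add, eval_smul, smul_eq_mul,
    h₀.comp_eval hp f x0 x1 x2, hp.comp_eval h₀ f x0 x1 x2, h₃.comp_eval hm f x0 x1 x2,
    hm.comp_eval h₃ f x0 x1 x2, hm.comp_eval hm f x0 x1 x2, hp.comp_eval hm f x0 x1 x2,
    hm.comp_eval hp f x0 x1 x2, h₃.comp_eval h₃ f x0 x1 x2, symbolZero, symbolThree, symbolPlus]
  field_simp
  ring

/-- The four difference operators satisfy the defining relations. -/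
theorem exists_algHom_of_isDiffOp (h₀ : IsDiffOp (symbolZero s₁) L₀)
    (h₃ : IsDiffOp (symbolThree s₁) L₃) (hp : IsDiffOp (symbolPlus s₁ s₂ s₃ s₄) Lp)
    (hm : IsDiffOp (fun _ => -1/2) Lm) :
    ∃ ρ : SkAlg →ₐ[ℂ] Module.End ℂ ℂ[X],
      ρ (S .zero) = L₀ ∧ ρ (S .three) = L₃ ∧ ρ (S .plus) = Lp ∧ ρ (S .minus) = Lm := by
  let F : FreeAlgebra ℂ Gen →ₐ[ℂ] Module.End ℂ ℂ[X] := FreeAlgebra.lift ℂ fun g =>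
    match g with
    | .zero => L₀
    | .three => L₃
    | .plus => Lp
    | .minus => Lm
  have F0 : F (gen .zero) = L₀ := by simp [F, gen]
  have F3 : F (gen .three) = L₃ := by simp [F, gen]
  have Fp : F (gen .plus) = Lp := by simp [F, gen]
  have Fm : F (gen .minus) = Lm := by simp [F, gen]
  have hac : ∀ u v, F (acomm u v) = acomm (F u) (F v) := by intro u v; simp [acomm]
  have hli : ∀ u v, F ⁅u, v⁆ = ⁅F u, F v⁆ := by intro u v; simp [Ring.lie_def]
  have hF : ∀ ⦃u v⦄, Rel u v → F u = F v := by
    rintro u v (_ | _ | _ | _ | _ | _) <;>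
      simp only [hac, hli, map_neg, map_sub, map_add, map_smul, F0, F3, Fp, Fm]
    · exact lie_zero_minus h₀ hm
    · exact lie_zero_plus h₀ h₃ hp hm
    · exact lie_plus_minus h₀ h₃ hp hm
    · exact lie_zero_three h₀ h₃ hm
    · exact lie_three_plus h₀ h₃ hp
    · exact lie_three_minus h₀ h₃ hm
  refine ⟨RingQuot.liftAlgHom ℂ ⟨F, hF⟩, ?_⟩
  simp only [S, RingQuot.liftAlgHom_mkAlgHom_apply]
  exact ⟨F0, F3, Fp, Fm⟩

end Relations

theorem skAlg_algHom_ext {A : Type*} [Semiring A] [Algebra ℂ A] {ρ τ : SkAlg →ₐ[ℂ] A}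
    (h : ∀ g, ρ (S g) = τ (S g)) : ρ = τ :=
  RingQuot.ringQuot_ext' _ _ _ (FreeAlgebra.hom_ext (funext h))

/-! ### The action on Wilson polynomials -/

section Action

variable (n : ℕ) (a b c d : ℂ)

/-- The image of `W̃_n(a, b, c, d)` under `S₀`. -/
noncomputable def actZero : ℂ[X] :=
  (4 * sigma a b c d * (n + c + d - 1)) • wilsonTilde n (a + 1/2) (b + 1/2) (c - 1/2) (d - 1/2)
    + ((4 * sigma a b c d * (a * b - c * d) - e1 a b c d) * n * (n + e1 a b c d - 1)) •
      wilsonTilde (n - 1) (a + 1/2) (b + 1/2) (c + 1/2) (d + 1/2)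
    - (4 * sigma a b c d * (n + a + b - 1)) •
      wilsonTilde n (a - 1/2) (b - 1/2) (c + 1/2) (d + 1/2)

/-- The image of `W̃_n(a, b, c, d)` under `S₃`. -/
noncomputable def actThree : ℂ[X] :=
  - (4 * (n + a + b - 1) : ℂ) • wilsonTilde n (a - 1/2) (b - 1/2) (c + 1/2) (d + 1/2)
    + (1/2 * (8 * (a * b + c * d) - e1 a b c d ^ 2 - 1) * n * (n + e1 a b c d - 1)) •
      wilsonTilde (n - 1) (a + 1/2) (b + 1/2) (c + 1/2) (d + 1/2)
    - (4 * (n + c + d - 1) : ℂ) • wilsonTilde n (a + 1/2) (b + 1/2) (c - 1/2) (d - 1/2)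

/-- The image of `W̃_n(a, b, c, d)` under `S₋`. -/
noncomputable def actMinus : ℂ[X] :=
  - (1/2 * n * (n + e1 a b c d - 1)) •
    wilsonTilde (n - 1) (a + 1/2) (b + 1/2) (c + 1/2) (d + 1/2)

/-- The image of `W̃_n(a, b, c, d)` under `S₊`. -/
noncomputable def actPlus : ℂ[X] :=
  (128 : ℂ) • wilsonTilde (n + 1) (a - 1/2) (b - 1/2) (c - 1/2) (d - 1/2)
    + (8 * (6 * alpha a b c d - 1 + 2 * beta a b c d * sigma a b c d) * (n + a + b - 1)) •
      wilsonTilde n (a - 1/2) (b - 1/2) (c + 1/2) (d + 1/2)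
    + (8 * (6 * alpha a b c d - 1 - 2 * beta a b c d * sigma a b c d) * (n + c + d - 1)) •
      wilsonTilde n (a + 1/2) (b + 1/2) (c - 1/2) (d - 1/2)
    + (8 * ((1 - 6 * alpha a b c d) * (a * b + c * d)
          - 2 * beta a b c d * sigma a b c d * (a * b - c * d) + xi a b c d)
        * n * (n + e1 a b c d - 1)) •
      wilsonTilde (n - 1) (a + 1/2) (b + 1/2) (c + 1/2) (d + 1/2)

variable {a b c d}

/-- The two monic quadratics in x/2 differ by a linear function with slope (a+b-c-d)/2 in x, which σ
normalizes. This removes from the symbols the asymmetry between the pairs a, b and c, d. -/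
theorem sigma_mul_sub (h : a + b - c - d ≠ 0) (x : ℂ) :
    sigma a b c d * ((a - 1/2 + x/2) * (b - 1/2 + x/2) - (c - 1/2 + x/2) * (d - 1/2 + x/2))
      = sigma a b c d * (a * b - c * d) + (x - 1) / 2 := by
  have hs : sigma a b c d * (a + b - c - d) = 1 := inv_mul_cancel₀ h
  linear_combination (x - 1) / 2 * hs

theorem actZero_eval (h : a + b - c - d ≠ 0) (x : ℂ) :
    x * (actZero n a b c d).eval (x ^ 2)
      = diffNum (symbolZero (e1 a b c d)) (wilsonTilde n a b c d) x := by
  have hφ : ∀ x, symbolZero (e1 a b c d) x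
      = 4 * sigma a b c d * ((c - 1/2 + x/2) * (d - 1/2 + x/2))
        + (4 * sigma a b c d * (a * b - c * d) - e1 a b c d)
        - 4 * sigma a b c d * ((a - 1/2 + x/2) * (b - 1/2 + x/2)) := by
    intro x
    rw [symbolZero]
    linear_combination 4 * sigma_mul_sub h x
  have hD := diffNum_one_wilsonTilde n a b c d x
  have hA := diffNum_ab_wilsonTilde n a b c d x
  have hB := diffNum_cd_wilsonTilde n a b c d x
  simp only [diffNum] at hD hA hB
  simp only [diffNum, hφ, actZero, eval_add, eval_sub, eval_smul, smul_eq_mul]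
  linear_combination -(4 * sigma a b c d) * hB
    - (4 * sigma a b c d * (a * b - c * d) - e1 a b c d) * hD + 4 * sigma a b c d * hA

theorem actThree_eval (x : ℂ) :
    x * (actThree n a b c d).eval (x ^ 2)
      = diffNum (symbolThree (e1 a b c d)) (wilsonTilde n a b c d) x := by
  have hφ : ∀ x, symbolThree (e1 a b c d) x
      = -4 * ((a - 1/2 + x/2) * (b - 1/2 + x/2))
        + 1/2 * (8 * (a * b + c * d) - e1 a b c d ^ 2 - 1)
        - 4 * ((c - 1/2 + x/2) * (d - 1/2 + x/2)) := by
    intro x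
    rw [symbolThree, e1]
    ring
  have hD := diffNum_one_wilsonTilde n a b c d x
  have hA := diffNum_ab_wilsonTilde n a b c d x
  have hB := diffNum_cd_wilsonTilde n a b c d x
  simp only [diffNum] at hD hA hB
  simp only [diffNum, hφ, actThree, eval_add, eval_sub, eval_smul, smul_eq_mul]
  linear_combination 4 * hA - 1/2 * (8 * (a * b + c * d) - e1 a b c d ^ 2 - 1) * hD + 4 * hB

theorem actMinus_eval (x : ℂ) :
    x * (actMinus n a b c d).eval (x ^ 2)
      = diffNum (fun _ => -1/2) (wilsonTilde n a b c d) x := by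
  have hD := diffNum_one_wilsonTilde n a b c d x
  simp only [diffNum] at hD
  simp only [diffNum, actMinus, eval_smul, smul_eq_mul]
  linear_combination 1/2 * hD

theorem actPlus_eval (h : a + b - c - d ≠ 0) (x : ℂ) :
    x * (actPlus n a b c d).eval (x ^ 2)
      = diffNum (symbolPlus (e1 a b c d) (e2 a b c d) (e3 a b c d) (e4 a b c d))
          (wilsonTilde n a b c d) x := by
  have hφ : ∀ x, symbolPlus (e1 a b c d) (e2 a b c d) (e3 a b c d) (e4 a b c d) x
      = 128 * ((a - 1/2 + x/2) * (b - 1/2 + x/2) * (c - 1/2 + x/2) * (d - 1/2 + x/2))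
        + 8 * (6 * alpha a b c d - 1 + 2 * beta a b c d * sigma a b c d)
          * ((a - 1/2 + x/2) * (b - 1/2 + x/2))
        + 8 * (6 * alpha a b c d - 1 - 2 * beta a b c d * sigma a b c d)
          * ((c - 1/2 + x/2) * (d - 1/2 + x/2))
        + 8 * ((1 - 6 * alpha a b c d) * (a * b + c * d)
          - 2 * beta a b c d * sigma a b c d * (a * b - c * d) + xi a b c d) := by
    intro x
    -- The three terms containing σ add up to 8β(x-1); this is the form with σ eliminated.
    have hβ : symbolPlus (e1 a b c d) (e2 a b c d) (e3 a b c d) (e4 a b c d) x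
        = 128 * ((a - 1/2 + x/2) * (b - 1/2 + x/2) * (c - 1/2 + x/2) * (d - 1/2 + x/2))
        + 8 * (6 * alpha a b c d - 1) * ((a - 1/2 + x/2) * (b - 1/2 + x/2)
          + (c - 1/2 + x/2) * (d - 1/2 + x/2) - (a * b + c * d))
        + 8 * beta a b c d * (x - 1) + 8 * xi a b c d := by
      simp only [symbolPlus, alpha, beta, xi, e1, e2, e3, e4]
      ring
    rw [hβ]
    linear_combination -16 * beta a b c d * sigma_mul_sub h x
  have hD := diffNum_one_wilsonTilde n a b c d x
  have hA := diffNum_ab_wilsonTilde n a b c d x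
  have hB := diffNum_cd_wilsonTilde n a b c d x
  have hE := diffNum_abcd_wilsonTilde n a b c d x
  simp only [diffNum] at hD hA hB hE
  simp only [diffNum, hφ, actPlus, eval_add, eval_smul, smul_eq_mul]
  linear_combination -128 * hE
    - 8 * (6 * alpha a b c d - 1 + 2 * beta a b c d * sigma a b c d) * hA
    - 8 * (6 * alpha a b c d - 1 - 2 * beta a b c d * sigma a b c d) * hB
    - 8 * ((1 - 6 * alpha a b c d) * (a * b + c * d)
          - 2 * beta a b c d * sigma a b c d * (a * b - c * d) + xi a b c d) * hD

end Action

end RationalSklyanin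

open RationalSklyanin
-- Existence and uniqueness of the representation
theorem mainTheorem2 (a b c d : ℝ) (ha : 0 < a) (hb : 0 < b) (hc : 0 < c) (hd : 0 < d)
    (hσ : a + b ≠ c + d) :
    -- the rescaled Wilson polynomials form a basis of the space of polynomials in `x²`
    (LinearIndependent ℂ (fun n : ℕ => wilsonTilde n a b c d) ∧
      Submodule.span ℂ (Set.range fun n : ℕ => wilsonTilde n a b c d) = ⊤) ∧
    -- the actions on this basis define a representation
    ∃! ρ : SkAlg →ₐ[ℂ] Module.End ℂ (Polynomial ℂ), ∀ n : ℕ,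
      ρ (S .zero) (wilsonTilde n a b c d) =
          (4 * sigma a b c d * (n + c + d - 1)) •
            wilsonTilde n (a + 1/2) (b + 1/2) (c - 1/2) (d - 1/2)
        + ((4 * sigma a b c d * (a * b - c * d) - e1 a b c d) * n * (n + e1 a b c d - 1)) •
            wilsonTilde (n - 1) (a + 1/2) (b + 1/2) (c + 1/2) (d + 1/2)
        - (4 * sigma a b c d * (n + a + b - 1)) •
            wilsonTilde n (a - 1/2) (b - 1/2) (c + 1/2) (d + 1/2) ∧
      ρ (S .three) (wilsonTilde n a b c d) =
        - (4 * (n + a + b - 1) : ℂ) •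
            wilsonTilde n (a - 1/2) (b - 1/2) (c + 1/2) (d + 1/2)
        + (1/2 * (8 * (a * b + c * d) - e1 a b c d ^ 2 - 1) * n * (n + e1 a b c d - 1)) •
            wilsonTilde (n - 1) (a + 1/2) (b + 1/2) (c + 1/2) (d + 1/2)
        - (4 * (n + c + d - 1) : ℂ) •
            wilsonTilde n (a + 1/2) (b + 1/2) (c - 1/2) (d - 1/2) ∧
      ρ (S .minus) (wilsonTilde n a b c d) =
        - (1/2 * n * (n + e1 a b c d - 1)) •
            wilsonTilde (n - 1) (a + 1/2) (b + 1/2) (c + 1/2) (d + 1/2) ∧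
      ρ (S .plus) (wilsonTilde n a b c d) =
          (128 : ℂ) • wilsonTilde (n + 1) (a - 1/2) (b - 1/2) (c - 1/2) (d - 1/2)
        + (8 * (6 * alpha a b c d - 1 + 2 * beta a b c d * sigma a b c d) * (n + a + b - 1)) •
            wilsonTilde n (a - 1/2) (b - 1/2) (c + 1/2) (d + 1/2)
        + (8 * (6 * alpha a b c d - 1 - 2 * beta a b c d * sigma a b c d) * (n + c + d - 1)) •
            wilsonTilde n (a + 1/2) (b + 1/2) (c - 1/2) (d - 1/2)
        + (8 * ((1 - 6 * alpha a b c d) * (a * b + c * d)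
              - 2 * beta a b c d * sigma a b c d * (a * b - c * d) + xi a b c d)
            * n * (n + e1 a b c d - 1)) •
            wilsonTilde (n - 1) (a + 1/2) (b + 1/2) (c + 1/2) (d + 1/2) := by
  have hpoch : ∀ n : ℕ, poch (n + a + b + c + d - 1) n ≠ 0 := poch_wilson_ne_zero (by positivity)
  have hli : LinearIndependent ℂ (fun n : ℕ => wilsonTilde n a b c d) :=
    (wilsonSequence hpoch).linearIndependent
  have hspan : Submodule.span ℂ (Set.range fun n : ℕ => wilsonTilde n a b c d) = ⊤ :=
    (wilsonSequence hpoch).span fun n =>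
      (Polynomial.leadingCoeff_ne_zero.mpr ((wilsonSequence hpoch).ne_zero n)).isUnit
  have hne : (a + b - c - d : ℂ) ≠ 0 := by
    norm_cast
    exact fun h => hσ (by linarith)
  let w := Module.Basis.mk hli hspan.ge
  have hw : ∀ n, w n = wilsonTilde n a b c d := fun n => Module.Basis.mk_apply hli hspan.ge n
  -- Prescribing values on the basis defines the four endomorphisms; that they are difference
  -- operators need only be checked there.
  have hext : ∀ v : ℕ → Polynomial ℂ, ∃ L : Module.End ℂ (Polynomial ℂ),
      ∀ n : ℕ, L (wilsonTilde n a b c d) = v n := fun v =>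
    ⟨w.constr ℂ v, fun n => by rw [← hw, Module.Basis.constr_basis]⟩
  refine ⟨⟨hli, hspan⟩, existsUnique_of_exists_of_unique ?_ ?_⟩
  · obtain ⟨L₀, hL₀⟩ := hext fun n => actZero n a b c d
    obtain ⟨L₃, hL₃⟩ := hext fun n => actThree n a b c d
    obtain ⟨Lm, hLm⟩ := hext fun n => actMinus n a b c d
    obtain ⟨Lp, hLp⟩ := hext fun n => actPlus n a b c d
    obtain ⟨ρ, h₀, h₃, hp, hm⟩ := exists_algHom_of_isDiffOp
      (isDiffOp_of_span hspan fun n x => (hL₀ n).symm ▸ actZero_eval n hne x)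
      (isDiffOp_of_span hspan fun n x => (hL₃ n).symm ▸ actThree_eval n x)
      (isDiffOp_of_span hspan fun n x => (hLp n).symm ▸ actPlus_eval n hne x)
      (isDiffOp_of_span hspan fun n x => (hLm n).symm ▸ actMinus_eval n x)
    exact ⟨ρ, fun n => ⟨h₀ ▸ hL₀ n, h₃ ▸ hL₃ n, hm ▸ hLm n, hp ▸ hLp n⟩⟩
  · intro ρ τ hρ hτ
    refine skAlg_algHom_ext fun g => w.ext fun n => ?_
    rw [hw]
    obtain ⟨r₀, r₃, rm, rp⟩ := hρ n
    obtain ⟨t₀, t₃, tm, tp⟩ := hτ n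
    cases g with
    | zero => rw [r₀, t₀]
    | three => rw [r₃, t₃]
    | plus => rw [rp, tp]
    | minus => rw [rm, tm]
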